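/- For each $n$ let $X_1,\dots,X_n$ (which may depend on $n$) be identically distributed, 1-dependent random variables with values in the non-negative integers, where 1-dependent means that the $\sigma$-algebras generated by $X_1,\dots,X_s$ and by $X_t,\dots,X_n$ are independent whenever $1\le s<t\le n$ and $t-s>1$. Put $S_n=X_1+\dots+X_n$, $\nu_1=\mathbb E X_1$, $\nu_2=\mathbb E X_1(X_1-1)$ and $\nu_{1,1}=\max_{1\le k<n}\mathbb E X_kX_{k+1}$ (which is $\mathbb E X_1X_2$ when $\mathbb E X_kX_{k+1}$ does not depend on $k$, for instance for stationary sequences). Let $C_0\ge 1$ be a constant not depending on $n$, let $x=x_n$ be a positive integer, put $$y=\frac{x-n\nu_1}{n\nu_1},\qquad \gamma=\mathrm e^{1.5C_0}\max(\nu_1^2,\nu_2,\nu_{1,1}),$$ and let $Z_n$ be a Poisson random variable with parameter $n\nu_1$. Suppose that, for all sufficiently large $n$, $$X_1\le C_0\ \text{a.s.},\qquad \mathrm e^{5C_0}\nu_1\le 0.002,\qquad |y|\le\tfrac1{10},\qquad \nu_2\le\frac{\nu_1\mathrm e^{-1.5C_0}}{20},\qquad \nu_{1,1}\le\frac{\nu_1\mathrm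 e^{-1.5C_0}}{20},$$ and that, as $n\to\infty$, $$x-n\nu_1=o(\sqrt{n\nu_1}),\qquad \gamma=o(\nu_1),\qquad \nu_1=o(1),\qquad n\nu_1\to\infty.$$ Then $$\frac{\mathbb P(S_n=x)}{\mathbb P(Z_n=x)}=1+o(1)\qquad(n\to\infty).$$ -/

import Mathlib

open MeasureTheory ProbabilityTheory Filter Topology Asymptotics

noncomputable section

namespace LocalPoisson

/-- The finite sequence `X 1, …, X n` is `m`-dependent: whenever `1 ≤ s < t` and `t - s > m`, the
sigma-algebras generated by `X 1, …, X s` and by `X t, …, X n` are independent. -/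
def IsMDependent {Ω : Type*} [MeasurableSpace Ω] (m n : ℕ) (X : ℕ → Ω → ℕ) (μ : Measure Ω) :
    Prop :=
  ∀ s t : ℕ, 1 ≤ s → s + m < t →
    Indep (⨆ i ∈ Finset.Icc 1 s, MeasurableSpace.comap (X i) inferInstance)
      (⨆ j ∈ Finset.Icc t n, MeasurableSpace.comap (X j) inferInstance) μ

/-- The mean `ν₁ = E X₁`. -/
def nu1 {Ω : Type*} [MeasurableSpace Ω] (X : ℕ → Ω → ℕ) (μ : Measure Ω) : ℝ :=
  ∫ ω, (X 1 ω : ℝ) ∂μ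

/-- The second factorial moment `ν₂ = E X₁ (X₁ - 1)`. -/
def nu2 {Ω : Type*} [MeasurableSpace Ω] (X : ℕ → Ω → ℕ) (μ : Measure Ω) : ℝ :=
  ∫ ω, (X 1 ω : ℝ) * ((X 1 ω : ℝ) - 1) ∂μ

/-- The largest mixed moment of two neighbours, `max_{1 ≤ k < n} E X_k X_{k+1}` (and `0` if there
are no neighbours). It is `E X₁ X₂` as soon as `E X_k X_{k+1}` does not depend on `k`. -/
def nu11 {Ω : Type*} [MeasurableSpace Ω] (n : ℕ) (X : ℕ → Ω → ℕ) (μ : Measure Ω) : ℝ :=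
  ⨆ k : Finset.Ico 1 n, ∫ ω, (X k ω : ℝ) * (X (k + 1) ω : ℝ) ∂μ

/-- `γ = exp(1.5 C₀) max(ν₁², ν₂, max_k E X_k X_{k+1})`. -/
def gam {Ω : Type*} [MeasurableSpace Ω] (C₀ : ℝ) (n : ℕ) (X : ℕ → Ω → ℕ) (μ : Measure Ω) : ℝ :=
  Real.exp (1.5 * C₀) * max (nu1 X μ ^ 2) (max (nu2 X μ) (nu11 n X μ))

/-- `y = (x - n ν₁) / (n ν₁)`. -/
def relDev {Ω : Type*} [MeasurableSpace Ω] (n : ℕ) (X : ℕ → Ω → ℕ) (μ : Measure Ω) (x : ℕ) : ℝ :=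
  ((x : ℝ) - n * nu1 X μ) / (n * nu1 X μ)

/-- The standing assumptions on `X 1, …, X n` and the positive integer `x`: identically distributed
1-dependent random variables with values in the non-negative integers, subject to the bounds below.
-/
structure Setting {Ω : Type*} [MeasurableSpace Ω] (C₀ : ℝ) (n : ℕ) (X : ℕ → Ω → ℕ)
    (μ : Measure Ω) (x : ℕ) : Prop where
  measurable : ∀ k ∈ Finset.Icc 1 n, Measurable (X k)
  identDistrib : ∀ k ∈ Finset.Icc 1 n, IdentDistrib (X k) (X 1) μ μ
  oneDependent : IsMDependent 1 n X μ
  x_pos : 0 < x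
  bounded : ∀ᵐ ω ∂μ, (X 1 ω : ℝ) ≤ C₀
  nu1_le : Real.exp (5 * C₀) * nu1 X μ ≤ 0.002
  relDev_le : |relDev n X μ x| ≤ 1 / 10
  nu2_le : nu2 X μ ≤ nu1 X μ * Real.exp (-1.5 * C₀) / 20
  nu11_le : nu11 n X μ ≤ nu1 X μ * Real.exp (-1.5 * C₀) / 20

/-- `P(S_n = x)` for `S_n = X 1 + ⋯ + X n`. -/
def probSum {Ω : Type*} [MeasurableSpace Ω] (n : ℕ) (X : ℕ → Ω → ℕ) (μ : Measure Ω) (x : ℕ) : ℝ :=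
  μ.real {ω | ∑ k ∈ Finset.Icc 1 n, X k ω = x}

/-- `P(Z_n = x)` for a Poisson random variable `Z_n` with parameter `n ν₁` (which is `≥ 0`). -/
def probPoisson {Ω : Type*} [MeasurableSpace Ω] (n : ℕ) (X : ℕ → Ω → ℕ) (μ : Measure Ω) (x : ℕ) :
    ℝ :=
  (poissonMeasure (n * nu1 X μ).toNNReal).real {x}

end LocalPoisson

end

/-!
Heinrich's method. Let `u` be on the unit circle and `F k = E u ^ (X 1 + ⋯ + X (k - 1))`. Expanding
`∏ (1 + (u ^ X i - 1))` and grouping the terms by the last index at which the summand `1` is chosen,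
1-dependence gives a linear recursion `F (k + 1) = ∑ m ≤ k, F m * w m k` whose weights
`w m k = E ∏_{m < i ≤ k} (u ^ X i - 1)` decay geometrically in `k - m`, because among the factors
one can always separate independent ones. Hence `F` stays away from `0` relative to its predecessor,
only the terms `m = k, k - 1` matter, and `F (k + 1) / F k` is `exp (ν₁ (u - 1))` up to an error of
order `max(ν₁², ν₂, ν₁₁) ‖u - 1‖²`. Multiplying the ratios bounds the distance of the two generating
functions by `(max(ν₁², ν₂, ν₁₁) / ν₁) exp (-n ν₁ ‖u - 1‖² / 8)` up to a constant, and Fourier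
inversion turns this into `P(S_n = x) - P(Z_n = x) = o(1 / √(n ν₁))`. By Stirling's formula
`P(Z_n = x)` is at least of order `1 / √(n ν₁)` when `x - n ν₁ = O(√(n ν₁))`.
-/

namespace LocalPoisson

open Finset in
lemma prod_Icc_eq_sum_prod_mul_prod_sub_one {R : Type*} [CommRing R] (f : ℕ → R) (k : ℕ) :
    ∏ i ∈ Icc 1 k, f i =
      ∑ m ∈ range (k + 1), (∏ i ∈ Ico 1 m, f i) * ∏ i ∈ Ioc m k, (f i - 1) := by
  have expand := prod_add_ordered (Icc 1 k) (fun i => f i - 1) 1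
  simp only [Pi.one_apply, sub_add_cancel, one_mul] at expand
  rw [expand, range_eq_Ico, sum_eq_sum_Ico_succ_bot k.succ_pos]
  congr 1
  · simp [← Icc_add_one_left_eq_Ioc]
  · refine sum_congr (by ext; simp) fun m hm => ?_
    congr 2 <;> ext i <;> simp at hm ⊢ <;> omega

section Recursion

lemma norm_le_two_pow_mul_norm_add {E : Type*} [SeminormedAddCommGroup E] {F : ℕ → E} {i d : ℕ}
    (h : ∀ k < i + d, ‖F (k + 1) - F k‖ ≤ 1 / 2 * ‖F k‖) : ‖F i‖ ≤ 2 ^ d * ‖F (i + d)‖ := by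
  induction d with
  | zero => simp
  | succ d ih =>
    have halve : ‖F (i + d)‖ ≤ 2 * ‖F (i + d + 1)‖ := by
      linarith [h (i + d) (by omega), norm_sub_norm_le (F (i + d)) (F (i + d + 1)),
        norm_sub_rev (F (i + d)) (F (i + d + 1))]
    calc ‖F i‖ ≤ 2 ^ d * ‖F (i + d)‖ := ih fun k hk => h k (by omega)
      _ ≤ 2 ^ d * (2 * ‖F (i + d + 1)‖) := by gcongr
      _ = 2 ^ (d + 1) * ‖F (i + (d + 1))‖ := by rw [pow_succ, ← add_assoc]; ring

/-- The linear recursion `F (k + 1) = ∑_{m ≤ k} F m * w m k`, `k ≤ n`, with weights `1` on the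
diagonal, bounded by `a` next to it and by `b / 4 ^ i` at distance `i + 2` from it. The smallness
of `a` and `b` keeps the ratio of consecutive values of `F` away from `0`, so that the terms far
from the diagonal are negligible. -/
structure IsDecayingRecursion {A : Type*} [SeminormedCommRing A] (F : ℕ → A) (w : ℕ → ℕ → A)
    (n : ℕ) (a b : ℝ) : Prop where
  rec_eq : ∀ k ≤ n, F (k + 1) = ∑ m ∈ Finset.range (k + 1), F m * w m k
  diag : ∀ k ≤ n, w k k = 1
  norm_succ_le : ∀ k < n, ‖w k (k + 1)‖ ≤ a
  norm_add_two_le : ∀ m i, m + i + 2 ≤ n → ‖w m (m + i + 2)‖ ≤ b * (1 / 4) ^ i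
  nonneg_left : 0 ≤ a
  nonneg_right : 0 ≤ b
  small : 2 * a + 8 * b ≤ 1 / 2

namespace IsDecayingRecursion

variable {A : Type*} [SeminormedCommRing A] {F : ℕ → A} {w : ℕ → ℕ → A} {n k : ℕ} {a b : ℝ}

lemma norm_sum_range_le (h : IsDecayingRecursion F w n a b) (hk : k < n)
    (hF : ∀ i < k + 1, ‖F (i + 1) - F i‖ ≤ 1 / 2 * ‖F i‖) :
    ‖∑ m ∈ Finset.range k, F m * w m (k + 1)‖ ≤ 8 * b * ‖F (k + 1)‖ := by
  have hb := h.nonneg_right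
  have term_le : ∀ i ∈ Finset.range k, ‖F (k - 1 - i) * w (k - 1 - i) (k + 1)‖ ≤
      4 * b * ‖F (k + 1)‖ * (1 / 2) ^ i := by
    intro i hi
    obtain ⟨m, rfl⟩ : ∃ m, k = m + i + 1 :=
      ⟨k - 1 - i, by have := Finset.mem_range.1 hi; omega⟩
    have hm : m + i + 1 - 1 - i = m := by omega
    have growth : ‖F m‖ ≤ 2 ^ (i + 2) * ‖F (m + (i + 2))‖ := norm_le_two_pow_mul_norm_add hF
    rw [hm]
    calc ‖F m * w m (m + i + 2)‖ ≤ ‖F m‖ * ‖w m (m + i + 2)‖ := norm_mul_le _ _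
      _ ≤ (2 ^ (i + 2) * ‖F (m + (i + 2))‖) * (b * (1 / 4) ^ i) := by
        gcongr
        exact h.norm_add_two_le m i hk
      _ = 4 * b * ‖F (m + i + 1 + 1)‖ * (2 * (1 / 4)) ^ i := by
        rw [mul_pow]
        ring_nf
      _ = 4 * b * ‖F (m + i + 1 + 1)‖ * (1 / 2) ^ i := by norm_num
  rw [← Finset.sum_range_reflect]
  calc ‖∑ i ∈ Finset.range k, F (k - 1 - i) * w (k - 1 - i) (k + 1)‖
      ≤ ∑ i ∈ Finset.range k, 4 * b * ‖F (k + 1)‖ * (1 / 2) ^ i := norm_sum_le_of_le _ term_le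
    _ = 4 * b * ‖F (k + 1)‖ * ∑ i ∈ Finset.range k, (1 / 2) ^ i := by rw [Finset.mul_sum]
    _ ≤ 4 * b * ‖F (k + 1)‖ * 2 := by
      gcongr
      exact sum_geometric_two_le k
    _ = 8 * b * ‖F (k + 1)‖ := by ring

lemma succ_eq (h : IsDecayingRecursion F w n a b) (hk : k < n) :
    F (k + 2) = F (k + 1) + F k * w k (k + 1) + ∑ m ∈ Finset.range k, F m * w m (k + 1) := by
  rw [h.rec_eq (k + 1) hk, Finset.sum_range_succ, Finset.sum_range_succ, h.diag (k + 1) hk]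
  ring

lemma norm_succ_sub_le (h : IsDecayingRecursion F w n a b) (hk : k ≤ n) :
    ‖F (k + 1) - F k‖ ≤ (2 * a + 8 * b) * ‖F k‖ := by
  have ha := h.nonneg_left
  have hb := h.nonneg_right
  induction k using Nat.strong_induction_on with
  | _ k ih =>
    rcases k with _ | k
    · have : F 1 = F 0 := by simpa [h.diag 0] using h.rec_eq 0 hk
      rw [zero_add, this, sub_self, norm_zero]
      positivity
    have half : ∀ i < k + 1, ‖F (i + 1) - F i‖ ≤ 1 / 2 * ‖F i‖ := fun i hi =>
      (ih i hi (by omega)).trans (mul_le_mul_of_nonneg_right h.small (norm_nonneg _))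
    have prev : ‖F k‖ ≤ 2 * ‖F (k + 1)‖ := by
      simpa using norm_le_two_pow_mul_norm_add (i := k) (d := 1) half
    rw [h.succ_eq hk, add_assoc, add_sub_cancel_left]
    calc ‖F k * w k (k + 1) + ∑ m ∈ Finset.range k, F m * w m (k + 1)‖
        ≤ ‖F k‖ * ‖w k (k + 1)‖ + ‖∑ m ∈ Finset.range k, F m * w m (k + 1)‖ :=
          (norm_add_le _ _).trans (by gcongr; exact norm_mul_le _ _)
      _ ≤ (2 * ‖F (k + 1)‖) * a + 8 * b * ‖F (k + 1)‖ := by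
          gcongr
          exacts [h.norm_succ_le k hk, h.norm_sum_range_le hk half]
      _ = (2 * a + 8 * b) * ‖F (k + 1)‖ := by ring

lemma norm_succ_sub_le_half (h : IsDecayingRecursion F w n a b) (hk : k ≤ n) :
    ‖F (k + 1) - F k‖ ≤ 1 / 2 * ‖F k‖ :=
  (h.norm_succ_sub_le hk).trans (mul_le_mul_of_nonneg_right h.small (norm_nonneg _))

theorem norm_add_two_sub_le (h : IsDecayingRecursion F w n a b) (hk : k < n) :
    ‖F (k + 2) - (1 + w k (k + 1)) * F (k + 1)‖ ≤
      (2 * a * (2 * a + 8 * b) + 8 * b) * ‖F (k + 1)‖ := by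
  have ha := h.nonneg_left
  have hb := h.nonneg_right
  have half : ∀ i < k + 1, ‖F (i + 1) - F i‖ ≤ 1 / 2 * ‖F i‖ := fun i hi =>
    h.norm_succ_sub_le_half (by omega)
  have prev : ‖F k‖ ≤ 2 * ‖F (k + 1)‖ := by
    simpa using norm_le_two_pow_mul_norm_add (i := k) (d := 1) half
  have split : F (k + 2) - (1 + w k (k + 1)) * F (k + 1) =
      ∑ m ∈ Finset.range k, F m * w m (k + 1) - w k (k + 1) * (F (k + 1) - F k) := by
    rw [h.succ_eq hk]
    ring
  rw [split]
  calc ‖∑ m ∈ Finset.range k, F m * w m (k + 1) - w k (k + 1) * (F (k + 1) - F k)‖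
      ≤ ‖∑ m ∈ Finset.range k, F m * w m (k + 1)‖ + ‖w k (k + 1)‖ * ‖F (k + 1) - F k‖ :=
        (norm_sub_le _ _).trans (by gcongr; exact norm_mul_le _ _)
    _ ≤ 8 * b * ‖F (k + 1)‖ + a * ((2 * a + 8 * b) * (2 * ‖F (k + 1)‖)) := by
        gcongr
        exacts [h.norm_sum_range_le hk half, h.norm_succ_le k hk,
          (h.norm_succ_sub_le hk.le).trans (by gcongr)]
    _ = (2 * a * (2 * a + 8 * b) + 8 * b) * ‖F (k + 1)‖ := by ring

end IsDecayingRecursion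

variable {A : Type*} [SeminormedCommRing A] {F : ℕ → A} {n : ℕ} {r : A} {R δ : ℝ}

lemma norm_le_pow_mul_norm_zero (hδ : 0 ≤ δ) (hR : ‖r‖ + δ ≤ R)
    (hF : ∀ k < n, ‖F (k + 1) - r * F k‖ ≤ δ * ‖F k‖) : ‖F n‖ ≤ R ^ n * ‖F 0‖ := by
  have hR0 : 0 ≤ R := (add_nonneg (norm_nonneg r) hδ).trans hR
  induction n with
  | zero => simp
  | succ n ih =>
    calc ‖F (n + 1)‖ ≤ ‖F (n + 1) - r * F n‖ + ‖r * F n‖ := norm_le_norm_sub_add _ _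
      _ ≤ δ * ‖F n‖ + ‖r‖ * ‖F n‖ := add_le_add (hF n n.lt_succ_self) (norm_mul_le _ _)
      _ = (‖r‖ + δ) * ‖F n‖ := by ring
      _ ≤ R * (R ^ n * ‖F 0‖) := by
        gcongr
        exact ih fun k hk => hF k (by omega)
      _ = R ^ (n + 1) * ‖F 0‖ := by ring

theorem norm_sub_pow_mul_le (hδ : 0 ≤ δ) (hR : ‖r‖ + δ ≤ R)
    (hF : ∀ k < n, ‖F (k + 1) - r * F k‖ ≤ δ * ‖F k‖) :
    ‖F n - r ^ n * F 0‖ ≤ n * δ * R ^ (n - 1) * ‖F 0‖ := by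
  have hR0 : 0 ≤ R := (add_nonneg (norm_nonneg r) hδ).trans hR
  have hrR : ‖r‖ ≤ R := by linarith
  induction n with
  | zero => simp
  | succ n ih =>
    have hF' : ∀ k < n, ‖F (k + 1) - r * F k‖ ≤ δ * ‖F k‖ := fun k hk => hF k (by omega)
    calc ‖F (n + 1) - r ^ (n + 1) * F 0‖
        = ‖(F (n + 1) - r * F n) + r * (F n - r ^ n * F 0)‖ := by congr 1; ring
      _ ≤ δ * ‖F n‖ + ‖r‖ * ‖F n - r ^ n * F 0‖ :=
          norm_add_le_of_le (hF n n.lt_succ_self) (norm_mul_le _ _)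
      _ ≤ δ * (R ^ n * ‖F 0‖) + R * (n * δ * R ^ (n - 1) * ‖F 0‖) := by
          gcongr
          exacts [norm_le_pow_mul_norm_zero hδ hR hF', ih hF']
      _ = (n + 1 : ℕ) * δ * R ^ (n + 1 - 1) * ‖F 0‖ := by
          rcases n with _ | n
          · simp
          · rw [Nat.add_sub_cancel, Nat.add_sub_cancel]
            push_cast
            ring

end Recursion

section MixedMoment

lemma norm_prod_le_pow_card {ι 𝕜 : Type*} [NormedField 𝕜] {s : Finset ι} {f : ι → 𝕜} {C : ℝ}
    (hf : ∀ i ∈ s, ‖f i‖ ≤ C) : ‖∏ i ∈ s, f i‖ ≤ C ^ s.card := by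
  rw [norm_prod]
  exact (Finset.prod_le_prod (fun _ _ => norm_nonneg _) hf).trans_eq (Finset.prod_const C)

lemma measurable_iSup_comap_prod {Ω : Type*} {X : ℕ → Ω → ℕ} {s t : Finset ℕ} {E : Type*}
    [MeasurableSpace E] [CommMonoid E] [MeasurableMul₂ E] (f : ℕ → E) (hst : s ⊆ t) :
    Measurable[⨆ i ∈ t, MeasurableSpace.comap (X i) inferInstance]
      fun ω => ∏ i ∈ s, f (X i ω) :=
  Finset.measurable_fun_prod _ fun i hi =>
    ((measurable_from_top (f := f)).comp (comap_measurable (X i))).mono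
      (le_iSup₂ (f := fun i (_ : i ∈ t) => MeasurableSpace.comap (X i) inferInstance) i (hst hi))
      le_rfl

variable {Ω : Type*} [MeasurableSpace Ω] {μ : Measure Ω} {m n : ℕ} {X : ℕ → Ω → ℕ}
  {𝕜 : Type*} [RCLike 𝕜] {f g : ℕ → 𝕜} {s t : Finset ℕ}

/-- The mixed moment `E ∏_{i ∈ s} f (X i)`; for `f N = u ^ N` it is the probability generating
function of `∑_{i ∈ s} X i` at `u`. -/
noncomputable def mixedMoment {Ω : Type*} [MeasurableSpace Ω] {𝕜 : Type*} [RCLike 𝕜]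
    (X : ℕ → Ω → ℕ) (μ : Measure Ω) (f : ℕ → 𝕜) (s : Finset ℕ) : 𝕜 :=
  ∫ ω, ∏ i ∈ s, f (X i ω) ∂μ

@[simp]
lemma mixedMoment_empty [IsProbabilityMeasure μ] : mixedMoment X μ f ∅ = 1 := by
  simp [mixedMoment]

lemma mixedMoment_singleton (k : ℕ) : mixedMoment X μ f {k} = ∫ ω, f (X k ω) ∂μ := by
  simp [mixedMoment]

lemma norm_mixedMoment_le : ‖mixedMoment X μ f s‖ ≤ mixedMoment X μ (fun N => ‖f N‖) s := by
  simpa only [mixedMoment, norm_prod] using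
    norm_integral_le_integral_norm (fun ω => ∏ i ∈ s, f (X i ω))

lemma mixedMoment_nonneg {f : ℕ → ℝ} (hf : ∀ N, 0 ≤ f N) : 0 ≤ mixedMoment X μ f s :=
  integral_nonneg fun _ => Finset.prod_nonneg fun _ _ => hf _

lemma measurable_prod_comp (hX : ∀ i ∈ s, Measurable (X i)) (f : ℕ → 𝕜) :
    Measurable fun ω => ∏ i ∈ s, f (X i ω) :=
  Finset.measurable_fun_prod _ fun i hi => (measurable_from_top (f := f)).comp (hX i hi)

lemma integrable_prod_comp [IsFiniteMeasure μ] (hX : ∀ i ∈ s, Measurable (X i)) {C : ℝ}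
    (hf : ∀ N, ‖f N‖ ≤ C) : Integrable (fun ω => ∏ i ∈ s, f (X i ω)) μ := by
  exact .of_bound (measurable_prod_comp hX f).aestronglyMeasurable (C ^ s.card)
    (ae_of_all _ fun ω => norm_prod_le_pow_card fun _ _ => hf _)

lemma integrable_prod_mul_prod [IsFiniteMeasure μ] (hXs : ∀ i ∈ s, Measurable (X i))
    (hXt : ∀ i ∈ t, Measurable (X i)) {C D : ℝ} (hf : ∀ N, ‖f N‖ ≤ C) (hg : ∀ N, ‖g N‖ ≤ D) :
    Integrable (fun ω => (∏ i ∈ s, f (X i ω)) * ∏ i ∈ t, g (X i ω)) μ := by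
  exact (integrable_prod_comp hXs hf).mul_bdd (c := D ^ t.card)
    (measurable_prod_comp hXt g).aestronglyMeasurable (ae_of_all _ fun ω =>
      norm_prod_le_pow_card fun _ _ => hg _)

namespace IsMDependent

variable [IsProbabilityMeasure μ]

theorem integral_prod_mul_prod (h : IsMDependent m n X μ)
    (hX : ∀ k ∈ Finset.Icc 1 n, Measurable (X k)) (f g : ℕ → 𝕜) (hs : s ⊆ Finset.Icc 1 n)
    (ht : t ⊆ Finset.Icc 1 n) (hst : ∀ i ∈ s, ∀ j ∈ t, i + m < j) :
    ∫ ω, (∏ i ∈ s, f (X i ω)) * ∏ i ∈ t, g (X i ω) ∂μ =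
      mixedMoment X μ f s * mixedMoment X μ g t := by
  rcases s.eq_empty_or_nonempty with rfl | hne
  · simp [mixedMoment]
  have hs' : s ⊆ Finset.Icc 1 (s.max' hne) := fun i hi =>
    Finset.mem_Icc.2 ⟨(Finset.mem_Icc.1 (hs hi)).1, s.le_max' i hi⟩
  have ht' : t ⊆ Finset.Icc (s.max' hne + m + 1) n := fun j hj =>
    Finset.mem_Icc.2 ⟨hst _ (s.max'_mem hne) j hj, (Finset.mem_Icc.1 (ht hj)).2⟩
  refine IndepFun.integral_fun_mul_eq_mul_integral ?_
    (measurable_prod_comp (fun i hi => hX i (hs hi)) f).aestronglyMeasurable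
    (measurable_prod_comp (fun i hi => hX i (ht hi)) g).aestronglyMeasurable
  rw [IndepFun_iff_Indep]
  exact indep_of_indep_of_le
    (h _ _ (Finset.mem_Icc.1 (hs (s.max'_mem hne))).1 (Nat.lt_succ_self _))
    (measurable_iSup_comap_prod f hs').comap_le (measurable_iSup_comap_prod g ht').comap_le

/-- In the expansion of `∏_{i ≤ k} (1 + (f (X i) - 1))`, group the terms by the last index `m` at
which the summand `1` is chosen: the factors before `m` and after `m` are independent. -/
theorem mixedMoment_Ico_succ (h : IsMDependent 1 n X μ)
    (hX : ∀ k ∈ Finset.Icc 1 n, Measurable (X k)) {C : ℝ} (hf : ∀ N, ‖f N‖ ≤ C) {k : ℕ}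
    (hk : k ≤ n) :
    mixedMoment X μ f (Finset.Ico 1 (k + 1)) = ∑ m ∈ Finset.range (k + 1),
      mixedMoment X μ f (Finset.Ico 1 m) * mixedMoment X μ (fun N => f N - 1) (Finset.Ioc m k) := by
  have hf1 : ∀ N, ‖f N - 1‖ ≤ C + 1 := fun N => by
    simpa using norm_sub_le_of_le (hf N) (norm_one (α := 𝕜)).le
  have before : ∀ m ∈ Finset.range (k + 1), Finset.Ico 1 m ⊆ Finset.Icc 1 n := fun m hm i hi => by
    simp only [Finset.mem_range, Finset.mem_Ico, Finset.mem_Icc] at hm hi ⊢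
    omega
  have after (m : ℕ) : Finset.Ioc m k ⊆ Finset.Icc 1 n := fun i hi => by
    simp only [Finset.mem_Ioc, Finset.mem_Icc] at hi ⊢
    omega
  simp only [mixedMoment, Finset.Ico_add_one_right_eq_Icc, prod_Icc_eq_sum_prod_mul_prod_sub_one]
  rw [integral_finsetSum]
  · refine Finset.sum_congr rfl fun m hm =>
      h.integral_prod_mul_prod hX f (fun N => f N - 1) (before m hm) (after m) fun i hi j hj => ?_
    simp only [Finset.mem_Ico, Finset.mem_Ioc] at hi hj
    omega
  · exact fun m hm => integrable_prod_mul_prod (fun i hi => hX i (before m hm hi))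
      (fun i hi => hX i (after m hi)) hf hf1

lemma mixedMoment_Ioc_le (h : IsMDependent 1 n X μ) (hX : ∀ k ∈ Finset.Icc 1 n, Measurable (X k))
    {g : ℕ → ℝ} (hg : ∀ N, 0 ≤ g N) {C : ℝ} (hgC : ∀ N, g N ≤ C) {j k : ℕ} (hjk : j + 2 ≤ k)
    (hk : k ≤ n) :
    mixedMoment X μ g (Finset.Ioc j k) ≤
      C * (∫ ω, g (X (j + 1) ω) ∂μ) * mixedMoment X μ g (Finset.Ioc (j + 2) k) := by
  have hgn : ∀ N, ‖g N‖ ≤ C := fun N => by simpa only [Real.norm_of_nonneg (hg N)] using hgC N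
  have hs : {j + 1} ⊆ Finset.Icc 1 n := by
    simp only [Finset.singleton_subset_iff, Finset.mem_Icc]
    omega
  have hjk' : Finset.Ioc j k ⊆ Finset.Icc 1 n := fun i hi => by
    simp only [Finset.mem_Ioc, Finset.mem_Icc] at hi ⊢
    omega
  have ht : Finset.Ioc (j + 2) k ⊆ Finset.Icc 1 n :=
    (Finset.Ioc_subset_Ioc_left (by omega)).trans hjk'
  have split : Finset.Ioc j k = insert (j + 1) (insert (j + 2) (Finset.Ioc (j + 2) k)) := by
    ext i
    simp only [Finset.mem_insert, Finset.mem_Ioc]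
    omega
  rw [mul_assoc, ← mixedMoment_singleton, ← h.integral_prod_mul_prod hX g g hs ht fun i hi l hl =>
    by simp only [Finset.mem_singleton, Finset.mem_Ioc] at hi hl; omega, ← integral_const_mul,
    mixedMoment]
  refine integral_mono (integrable_prod_comp (fun i hi => hX i (hjk' hi)) hgn)
    ((integrable_prod_mul_prod (fun i hi => hX i (hs hi)) (fun i hi => hX i (ht hi))
      hgn hgn).const_mul C) fun ω => ?_
  beta_reduce
  rw [split, Finset.prod_insert (by simp), Finset.prod_insert (by simp), Finset.prod_singleton,
    mul_left_comm]
  exact mul_le_mul_of_nonneg_right (hgC _)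
    (mul_nonneg (hg _) (Finset.prod_nonneg fun _ _ => hg _))

theorem mixedMoment_Ioc_le_mul_pow (h : IsMDependent 1 n X μ)
    (hX : ∀ k ∈ Finset.Icc 1 n, Measurable (X k)) {g : ℕ → ℝ} (hg : ∀ N, 0 ≤ g N) {C a b q : ℝ}
    (hgC : ∀ N, g N ≤ C) (haq : C * a ≤ q ^ 2) (hab : C * a ^ 2 ≤ b * q)
    (hga : ∀ k ∈ Finset.Icc 1 n, ∫ ω, g (X k ω) ∂μ ≤ a)
    (hgb : ∀ k ∈ Finset.Ico 1 n, ∫ ω, g (X k ω) * g (X (k + 1) ω) ∂μ ≤ b) (j i : ℕ)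
    (hij : j + i + 2 ≤ n) :
    mixedMoment X μ g (Finset.Ioc j (j + i + 2)) ≤ b * q ^ i := by
  have hC : 0 ≤ C := (hg 0).trans (hgC 0)
  have mean_nonneg : ∀ k, 0 ≤ ∫ ω, g (X k ω) ∂μ := fun k => integral_nonneg fun ω => hg _
  have first_le := hga (j + 1) (Finset.mem_Icc.2 ⟨by omega, by omega⟩)
  have ha : 0 ≤ a := (mean_nonneg _).trans first_le
  induction i using Nat.twoStepInduction generalizing j with
  | zero =>
    have pair : Finset.Ioc j (j + 0 + 2) = {j + 1, j + 2} := by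
      ext i
      simp only [Finset.mem_Ioc, Finset.mem_insert, Finset.mem_singleton]
      omega
    simpa [mixedMoment, pair] using hgb (j + 1) (Finset.mem_Ico.2 ⟨by omega, by omega⟩)
  | one =>
    have third_le := hga (j + 3) (Finset.mem_Icc.2 ⟨by omega, by omega⟩)
    have last : Finset.Ioc (j + 2) (j + 3) = {j + 3} := Nat.Ioc_succ_singleton (j + 2)
    calc mixedMoment X μ g (Finset.Ioc j (j + 3))
        ≤ C * (∫ ω, g (X (j + 1) ω) ∂μ) * ∫ ω, g (X (j + 3) ω) ∂μ := by
          simpa only [last, mixedMoment_singleton] using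
            h.mixedMoment_Ioc_le hX hg hgC (j := j) (k := j + 3) (by omega) hij
      _ ≤ C * a * a := by
          gcongr
          exact mean_nonneg _
      _ ≤ b * q ^ 1 := by linarith
  | more i ih _ =>
    have rest_nonneg : 0 ≤ mixedMoment X μ g (Finset.Ioc (j + 2) (j + 2 + i + 2)) :=
      mixedMoment_nonneg hg
    rw [show j + (i + 2) + 2 = j + 2 + i + 2 by omega] at hij ⊢
    have rest_le := ih (j + 2) hij (hga _ (Finset.mem_Icc.2 ⟨by omega, by omega⟩))
    calc mixedMoment X μ g (Finset.Ioc j (j + 2 + i + 2))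
        ≤ C * (∫ ω, g (X (j + 1) ω) ∂μ) * mixedMoment X μ g (Finset.Ioc (j + 2) (j + 2 + i + 2)) :=
          h.mixedMoment_Ioc_le hX hg hgC (by omega) hij
      _ ≤ C * a * mixedMoment X μ g (Finset.Ioc (j + 2) (j + 2 + i + 2)) := by gcongr
      _ ≤ q ^ 2 * (b * q ^ i) := by gcongr
      _ = b * q ^ (i + 2) := by ring

end IsMDependent

end MixedMoment

section UnitDisc

variable {R : Type*} [SeminormedRing R] {u : R}

lemma norm_pow_sub_one_le (hu : ‖u‖ ≤ 1) (N : ℕ) : ‖u ^ N - 1‖ ≤ N * ‖u - 1‖ := by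
  induction N with
  | zero => simp
  | succ N ih =>
    calc ‖u ^ (N + 1) - 1‖ = ‖(u ^ N - 1) * u + (u - 1)‖ := by congr 1; noncomm_ring
      _ ≤ N * ‖u - 1‖ * 1 + ‖u - 1‖ :=
        norm_add_le_of_le ((norm_mul_le _ _).trans (by gcongr)) le_rfl
      _ = (N + 1 : ℕ) * ‖u - 1‖ := by push_cast; ring

lemma norm_pow_sub_one_sub_mul_le (hu : ‖u‖ ≤ 1) (N : ℕ) :
    ‖u ^ N - 1 - N * (u - 1)‖ ≤ N * (N - 1) / 2 * ‖u - 1‖ ^ 2 := by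
  induction N with
  | zero => simp
  | succ N ih =>
    calc ‖u ^ (N + 1) - 1 - (N + 1 : ℕ) * (u - 1)‖
        = ‖(u ^ N - 1 - N * (u - 1)) + (u ^ N - 1) * (u - 1)‖ := by
          congr 1
          push_cast
          noncomm_ring
      _ ≤ N * (N - 1) / 2 * ‖u - 1‖ ^ 2 + N * ‖u - 1‖ * ‖u - 1‖ :=
          norm_add_le_of_le ih ((norm_mul_le _ _).trans (by gcongr; exact norm_pow_sub_one_le hu N))
      _ = (N + 1 : ℕ) * ((N + 1 : ℕ) - 1) / 2 * ‖u - 1‖ ^ 2 := by push_cast; ring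

end UnitDisc

section GeneratingFunction

variable {Ω : Type*} [MeasurableSpace Ω] {μ : Measure Ω} {Y Z : Ω → ℕ} {u : ℂ}

lemma integral_norm_pow_sub_one_le (hY : Integrable (fun ω => (Y ω : ℝ)) μ) (hu : ‖u‖ ≤ 1) :
    ∫ ω, ‖u ^ Y ω - 1‖ ∂μ ≤ (∫ ω, (Y ω : ℝ) ∂μ) * ‖u - 1‖ := by
  rw [← integral_mul_const]
  exact integral_mono_of_nonneg (ae_of_all _ fun _ => norm_nonneg _) (hY.mul_const _)
    (ae_of_all _ fun ω => norm_pow_sub_one_le hu (Y ω))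

lemma integral_norm_pow_sub_one_mul_le (hYZ : Integrable (fun ω => (Y ω : ℝ) * (Z ω : ℝ)) μ)
    (hu : ‖u‖ ≤ 1) :
    ∫ ω, ‖u ^ Y ω - 1‖ * ‖u ^ Z ω - 1‖ ∂μ ≤
      (∫ ω, (Y ω : ℝ) * (Z ω : ℝ) ∂μ) * ‖u - 1‖ ^ 2 := by
  rw [← integral_mul_const]
  refine integral_mono_of_nonneg (ae_of_all _ fun _ => by positivity) (hYZ.mul_const _)
    (ae_of_all _ fun ω => ?_)
  calc ‖u ^ Y ω - 1‖ * ‖u ^ Z ω - 1‖ ≤ (Y ω * ‖u - 1‖) * (Z ω * ‖u - 1‖) := by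
        gcongr
        exacts [norm_pow_sub_one_le hu _, norm_pow_sub_one_le hu _]
    _ = Y ω * Z ω * ‖u - 1‖ ^ 2 := by ring

variable [IsFiniteMeasure μ]

lemma norm_integral_pow_sub_one_sub_le (hYm : Measurable Y)
    (hY : MemLp (fun ω => (Y ω : ℝ)) 2 μ) (hu : ‖u‖ ≤ 1) :
    ‖∫ ω, (u ^ Y ω - 1) ∂μ - (∫ ω, (Y ω : ℝ) ∂μ : ℝ) * (u - 1)‖ ≤
      (∫ ω, (Y ω : ℝ) * ((Y ω : ℝ) - 1) ∂μ) / 2 * ‖u - 1‖ ^ 2 := by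
  have int_Y : Integrable (fun ω => (Y ω : ℝ)) μ := hY.integrable one_le_two
  have int_fact : Integrable (fun ω => (Y ω : ℝ) * ((Y ω : ℝ) - 1)) μ := by
    simp only [mul_sub, mul_one]
    exact (hY.integrable_mul hY).sub int_Y
  have int_pow : Integrable (fun ω => u ^ Y ω - 1) μ :=
    (int_Y.mul_const ‖u - 1‖).mono'
      ((measurable_from_top (f := fun N => u ^ N - 1)).comp hYm).aestronglyMeasurable
      (ae_of_all _ fun ω => norm_pow_sub_one_le hu (Y ω))
  have int_mean : Integrable (fun ω => ((Y ω : ℝ) : ℂ) * (u - 1)) μ := int_Y.ofReal.mul_const _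
  rw [← integral_complex_ofReal, ← integral_mul_const, ← integral_sub int_pow int_mean,
    ← integral_div, ← integral_mul_const]
  refine norm_integral_le_of_norm_le ((int_fact.div_const 2).mul_const _) (ae_of_all _ fun ω => ?_)
  simpa using norm_pow_sub_one_sub_mul_le hu (Y ω)

theorem norm_one_add_integral_pow_sub_one_sub_exp_le (hYm : Measurable Y)
    (hY : MemLp (fun ω => (Y ω : ℝ)) 2 μ) (hu : ‖u‖ ≤ 1)
    (hYu : (∫ ω, (Y ω : ℝ) ∂μ) * ‖u - 1‖ ≤ 1) :
    ‖1 + ∫ ω, (u ^ Y ω - 1) ∂μ - Complex.exp ((∫ ω, (Y ω : ℝ) ∂μ : ℝ) * (u - 1))‖ ≤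
      ((∫ ω, (Y ω : ℝ) * ((Y ω : ℝ) - 1) ∂μ) / 2 + (∫ ω, (Y ω : ℝ) ∂μ) ^ 2) * ‖u - 1‖ ^ 2 := by
  have moment_le := norm_integral_pow_sub_one_sub_le hYm hY hu
  have mean_nonneg : 0 ≤ ∫ ω, (Y ω : ℝ) ∂μ := integral_nonneg fun _ => Nat.cast_nonneg _
  set m : ℝ := ∫ ω, (Y ω : ℝ) ∂μ
  have norm_eq : ‖(m : ℂ) * (u - 1)‖ = m * ‖u - 1‖ := by
    rw [norm_mul, Complex.norm_real, Real.norm_of_nonneg mean_nonneg]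
  have exp_le : ‖Complex.exp (m * (u - 1)) - 1 - m * (u - 1)‖ ≤ (m * ‖u - 1‖) ^ 2 := by
    rw [← norm_eq] at hYu ⊢
    exact Complex.norm_exp_sub_one_sub_id_le hYu
  calc ‖1 + ∫ ω, (u ^ Y ω - 1) ∂μ - Complex.exp (m * (u - 1))‖
      = ‖(∫ ω, (u ^ Y ω - 1) ∂μ - m * (u - 1)) -
          (Complex.exp (m * (u - 1)) - 1 - m * (u - 1))‖ := by congr 1; ring
    _ ≤ _ := norm_sub_le_of_le moment_le exp_le
    _ = _ := by ring

end GeneratingFunction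

section Moments

variable {Ω : Type*} [MeasurableSpace Ω] (n : ℕ) (X : ℕ → Ω → ℕ) (μ : Measure Ω)

/-- The scale `max(ν₁², ν₂, ν₁₁)` of the second moments, which is `γ` without its exponential
factor; it measures the distance of the sum from a Poisson variable. -/
noncomputable def maxMoment : ℝ :=
  max (nu1 X μ ^ 2) (max (nu2 X μ) (nu11 n X μ))

lemma sq_nu1_le_maxMoment : nu1 X μ ^ 2 ≤ maxMoment n X μ := le_max_left _ _

lemma nu2_le_maxMoment : nu2 X μ ≤ maxMoment n X μ := le_max_of_le_right (le_max_left _ _)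

lemma nu11_le_maxMoment : nu11 n X μ ≤ maxMoment n X μ := le_max_of_le_right (le_max_right _ _)

lemma maxMoment_nonneg : 0 ≤ maxMoment n X μ := (sq_nonneg _).trans (sq_nu1_le_maxMoment n X μ)

lemma nu1_nonneg : 0 ≤ nu1 X μ := integral_nonneg fun _ => Nat.cast_nonneg _

lemma sq_nu1_mul_norm_sub_one_le (u : ℂ) :
    (nu1 X μ * ‖u - 1‖) ^ 2 ≤ maxMoment n X μ * ‖u - 1‖ ^ 2 := by
  rw [mul_pow]
  gcongr
  exact sq_nu1_le_maxMoment n X μ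

variable {n X μ}

lemma integral_mul_le_nu11 {k : ℕ} (hk : k ∈ Finset.Ico 1 n) :
    ∫ ω, (X k ω : ℝ) * (X (k + 1) ω : ℝ) ∂μ ≤ nu11 n X μ :=
  le_ciSup (f := fun k : Finset.Ico 1 n => ∫ ω, (X k ω : ℝ) * (X (k + 1) ω : ℝ) ∂μ)
    (Set.finite_range _).bddAbove ⟨k, hk⟩

lemma nu1_le_of_mul_maxMoment_le {K : ℝ} (hK : 0 < K) (h : K * maxMoment n X μ ≤ nu1 X μ) :
    nu1 X μ ≤ 1 / K := by
  have nu1_mul_le : nu1 X μ * (nu1 X μ * K) ≤ nu1 X μ := by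
    calc nu1 X μ * (nu1 X μ * K) = K * nu1 X μ ^ 2 := by ring
      _ ≤ K * maxMoment n X μ := by gcongr; exact sq_nu1_le_maxMoment n X μ
      _ ≤ nu1 X μ := h
  rcases (nu1_nonneg X μ).eq_or_lt' with h0 | hpos
  · rw [h0]
    positivity
  · rw [le_div_iff₀ hK]
    exact le_of_mul_le_mul_left (by simpa using nu1_mul_le) hpos

lemma nu1_mul_norm_sub_one_le (hM : 600 * maxMoment n X μ ≤ nu1 X μ) {u : ℂ} (hu : ‖u‖ ≤ 1) :
    nu1 X μ * ‖u - 1‖ ≤ 1 / 300 := by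
  have norm_le_two : ‖u - 1‖ ≤ 2 := (norm_sub_le u 1).trans (by linarith [norm_one (α := ℂ)])
  calc nu1 X μ * ‖u - 1‖ ≤ 1 / 600 * 2 := by
        gcongr
        exact nu1_le_of_mul_maxMoment_le (by norm_num) hM
    _ = 1 / 300 := by norm_num

/-- The variables `X 1, …, X n` of one row of the array: identically distributed, 1-dependent and
square integrable. The last condition makes the integrals defining `nu1`, `nu2` and `nu11` honest;
it replaces the uniform bound `C₀` of `Setting`. -/
structure IsOneDependentRow {Ω : Type*} [MeasurableSpace Ω] (n : ℕ) (X : ℕ → Ω → ℕ)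
    (μ : Measure Ω) : Prop where
  measurable : ∀ k ∈ Finset.Icc 1 n, Measurable (X k)
  identDistrib : ∀ k ∈ Finset.Icc 1 n, IdentDistrib (X k) (X 1) μ μ
  oneDependent : IsMDependent 1 n X μ
  memLp : ∀ k ∈ Finset.Icc 1 n, MemLp (fun ω => (X k ω : ℝ)) 2 μ

lemma Setting.isOneDependentRow [IsFiniteMeasure μ] {C₀ : ℝ} {x : ℕ} (h : Setting C₀ n X μ x) :
    IsOneDependentRow n X μ where
  measurable := h.measurable
  identDistrib := h.identDistrib
  oneDependent := h.oneDependent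
  memLp k hk := by
    have bounded : ∀ᵐ ω ∂μ, (X k ω : ℝ) ≤ C₀ := (h.identDistrib k hk).symm.ae_snd
      (p := fun N : ℕ => (N : ℝ) ≤ C₀) MeasurableSet.of_discrete h.bounded
    refine .of_bound (measurable_from_top.comp (h.measurable k hk)).aestronglyMeasurable C₀ ?_
    filter_upwards [bounded] with ω hω
    simpa using hω

namespace IsOneDependentRow

lemma integral_comp_eq (h : IsOneDependentRow n X μ) {E : Type*} [NormedAddCommGroup E]
    [NormedSpace ℝ E] [MeasurableSpace E] [BorelSpace E] (f : ℕ → E) {k : ℕ}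
    (hk : k ∈ Finset.Icc 1 n) : ∫ ω, f (X k ω) ∂μ = ∫ ω, f (X 1 ω) ∂μ :=
  ((h.identDistrib k hk).comp (measurable_from_top (f := f))).integral_eq

variable {u : ℂ}

lemma integral_norm_pow_sub_one_le_nu1 [IsFiniteMeasure μ] (h : IsOneDependentRow n X μ)
    (hu : ‖u‖ ≤ 1) {k : ℕ} (hk : k ∈ Finset.Icc 1 n) :
    ∫ ω, ‖u ^ X k ω - 1‖ ∂μ ≤ nu1 X μ * ‖u - 1‖ := by
  rw [nu1, ← h.integral_comp_eq (fun N => (N : ℝ)) hk]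
  exact integral_norm_pow_sub_one_le ((h.memLp k hk).integrable one_le_two) hu

lemma integral_norm_mul_norm_le_maxMoment (h : IsOneDependentRow n X μ) (hu : ‖u‖ ≤ 1) {k : ℕ}
    (hk : k ∈ Finset.Ico 1 n) :
    ∫ ω, ‖u ^ X k ω - 1‖ * ‖u ^ X (k + 1) ω - 1‖ ∂μ ≤ maxMoment n X μ * ‖u - 1‖ ^ 2 := by
  obtain ⟨hk1, hkn⟩ := Finset.mem_Ico.1 hk
  have int_mul : Integrable (fun ω => (X k ω : ℝ) * (X (k + 1) ω : ℝ)) μ :=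
    (h.memLp k (Finset.mem_Icc.2 ⟨hk1, hkn.le⟩)).integrable_mul
      (h.memLp (k + 1) (Finset.mem_Icc.2 ⟨by omega, hkn⟩))
  refine (integral_norm_pow_sub_one_mul_le int_mul hu).trans ?_
  gcongr
  exact (integral_mul_le_nu11 hk).trans (nu11_le_maxMoment n X μ)

variable [IsProbabilityMeasure μ]

lemma norm_one_add_integral_sub_exp_le_maxMoment (h : IsOneDependentRow n X μ) (hu : ‖u‖ ≤ 1)
    (hνu : nu1 X μ * ‖u - 1‖ ≤ 1) {k : ℕ} (hk : k ∈ Finset.Icc 1 n) :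
    ‖1 + ∫ ω, (u ^ X k ω - 1) ∂μ - Complex.exp (nu1 X μ * (u - 1))‖ ≤
      2 * maxMoment n X μ * ‖u - 1‖ ^ 2 := by
  have mean_eq : ∫ ω, (X k ω : ℝ) ∂μ = nu1 X μ := h.integral_comp_eq _ hk
  have fact_eq : ∫ ω, (X k ω : ℝ) * ((X k ω : ℝ) - 1) ∂μ = nu2 X μ :=
    h.integral_comp_eq (fun N => (N : ℝ) * ((N : ℝ) - 1)) hk
  have exp_le := norm_one_add_integral_pow_sub_one_sub_exp_le (h.measurable k hk) (h.memLp k hk) hu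
    (by rwa [mean_eq])
  rw [mean_eq, fact_eq] at exp_le
  refine exp_le.trans (mul_le_mul_of_nonneg_right ?_ (sq_nonneg _))
  linarith [sq_nu1_le_maxMoment n X μ, nu2_le_maxMoment n X μ, maxMoment_nonneg n X μ]

theorem isDecayingRecursion (h : IsOneDependentRow n X μ) (hu : ‖u‖ ≤ 1)
    (hM : 600 * maxMoment n X μ ≤ nu1 X μ) :
    IsDecayingRecursion (fun m => mixedMoment X μ (fun N => u ^ N) (Finset.Ico 1 m))
      (fun m k => mixedMoment X μ (fun N => u ^ N - 1) (Finset.Ioc m k)) n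
      (nu1 X μ * ‖u - 1‖) (8 * maxMoment n X μ * ‖u - 1‖ ^ 2) := by
  have hν := nu1_nonneg X μ
  have hM0 := maxMoment_nonneg n X μ
  have norm_pow_le_one (N : ℕ) : ‖u ^ N‖ ≤ 1 :=
    (norm_pow_le u N).trans (pow_le_one₀ (norm_nonneg _) hu)
  have norm_sub_le_two (N : ℕ) : ‖u ^ N - 1‖ ≤ 2 :=
    (norm_sub_le _ _).trans (by linarith [norm_pow_le_one N, norm_one (α := ℂ)])
  have hνs := nu1_mul_norm_sub_one_le hM hu
  have hνMs := sq_nu1_mul_norm_sub_one_le n X μ u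
  have hMs0 : 0 ≤ maxMoment n X μ * ‖u - 1‖ ^ 2 := by positivity
  have hMs : maxMoment n X μ * ‖u - 1‖ ^ 2 ≤ 1 / 90000 := by
    have hs2 : ‖u - 1‖ ≤ 2 := by simpa using norm_sub_le_two 1
    have hνs0 : 0 ≤ nu1 X μ * ‖u - 1‖ := by positivity
    nlinarith
  refine ⟨fun k hk => h.oneDependent.mixedMoment_Ico_succ h.measurable norm_pow_le_one hk,
    fun k _ => by simp, fun k hk => ?_, fun m i hmi => ?_, by positivity, by positivity,
    by linarith⟩
  · refine norm_mixedMoment_le.trans ?_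
    rw [Nat.Ioc_succ_singleton, mixedMoment_singleton]
    exact h.integral_norm_pow_sub_one_le_nu1 hu (Finset.mem_Icc.2 ⟨by omega, hk⟩)
  · exact norm_mixedMoment_le.trans <| h.oneDependent.mixedMoment_Ioc_le_mul_pow h.measurable
      (fun _ => norm_nonneg _) norm_sub_le_two (by linarith) (by linarith)
      (fun k hk => h.integral_norm_pow_sub_one_le_nu1 hu hk)
      (fun k hk => (h.integral_norm_mul_norm_le_maxMoment hu hk).trans (by linarith)) m i hmi

theorem norm_mixedMoment_succ_sub_exp_mul_le (h : IsOneDependentRow n X μ) (hu : ‖u‖ ≤ 1)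
    (hM : 600 * maxMoment n X μ ≤ nu1 X μ) {k : ℕ} (hk : k < n) :
    ‖mixedMoment X μ (fun N => u ^ N) (Finset.Ico 1 (k + 2)) - Complex.exp (nu1 X μ * (u - 1)) *
        mixedMoment X μ (fun N => u ^ N) (Finset.Ico 1 (k + 1))‖ ≤
      75 * maxMoment n X μ * ‖u - 1‖ ^ 2 *
        ‖mixedMoment X μ (fun N => u ^ N) (Finset.Ico 1 (k + 1))‖ := by
  have recursion := h.isDecayingRecursion hu hM
  have step := recursion.norm_add_two_sub_le hk
  have hνs := nu1_mul_norm_sub_one_le hM hu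
  have factor := h.norm_one_add_integral_sub_exp_le_maxMoment hu (by linarith)
    (Finset.mem_Icc.2 ⟨by omega, hk⟩ : k + 1 ∈ Finset.Icc 1 n)
  simp only [Nat.Ioc_succ_singleton, mixedMoment_singleton] at step
  have coeff_le : 2 * (nu1 X μ * ‖u - 1‖) * (2 * (nu1 X μ * ‖u - 1‖) +
      8 * (8 * maxMoment n X μ * ‖u - 1‖ ^ 2)) + 8 * (8 * maxMoment n X μ * ‖u - 1‖ ^ 2) +
      2 * maxMoment n X μ * ‖u - 1‖ ^ 2 ≤ 75 * maxMoment n X μ * ‖u - 1‖ ^ 2 := by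
    have hνMs := sq_nu1_mul_norm_sub_one_le n X μ u
    have := mul_le_mul_of_nonneg_right hνs recursion.nonneg_right
    linarith [recursion.nonneg_right]
  set P := mixedMoment X μ (fun N => u ^ N) (Finset.Ico 1 (k + 1))
  set Q := mixedMoment X μ (fun N => u ^ N) (Finset.Ico 1 (k + 2))
  set w := ∫ ω, (u ^ X (k + 1) ω - 1) ∂μ
  calc ‖Q - Complex.exp (nu1 X μ * (u - 1)) * P‖
      = ‖(Q - (1 + w) * P) + (1 + w - Complex.exp (nu1 X μ * (u - 1))) * P‖ := by congr 1; ring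
    _ ≤ _ := norm_add_le_of_le step ((norm_mul_le _ _).trans
        (mul_le_mul_of_nonneg_right factor (norm_nonneg _)))
    _ ≤ 75 * maxMoment n X μ * ‖u - 1‖ ^ 2 * ‖P‖ := by
      rw [← add_mul]
      gcongr

end IsOneDependentRow

end Moments

section PoissonApproximation

lemma natCast_mul_exp_pow_pred_le {v : ℝ} (hv0 : 0 ≤ v) (hv1 : v ≤ 1) (n : ℕ) :
    n * v * Real.exp (-(v / 4)) ^ (n - 1) ≤ 16 * Real.exp (-(n * v / 8)) := by
  rcases n with _ | n
  · simp
  have half_le : 1 ≤ 2 * Real.exp (-(v / 4)) := by linarith [Real.one_sub_le_exp_neg (v / 4)]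
  have peak : (n + 1 : ℕ) * v / 8 * Real.exp (-((n + 1 : ℕ) * v / 8)) ≤ 1 :=
    (Real.mul_exp_neg_le_exp_neg_one _).trans (Real.exp_le_one_iff.2 (by norm_num))
  have square : Real.exp (-(v / 4)) ^ (n + 1) = Real.exp (-((n + 1 : ℕ) * v / 8)) ^ 2 := by
    rw [← Real.exp_nat_mul, ← Real.exp_nat_mul]
    congr 1
    push_cast
    ring
  rw [Nat.add_sub_cancel]
  calc (n + 1 : ℕ) * v * Real.exp (-(v / 4)) ^ n
      ≤ (n + 1 : ℕ) * v * Real.exp (-(v / 4)) ^ n * (2 * Real.exp (-(v / 4))) :=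
        le_mul_of_one_le_right (by positivity) half_le
    _ = 16 * ((n + 1 : ℕ) * v / 8 * Real.exp (-((n + 1 : ℕ) * v / 8))) *
          Real.exp (-((n + 1 : ℕ) * v / 8)) := by linear_combination 2 * (n + 1 : ℕ) * v * square
    _ ≤ 16 * 1 * Real.exp (-((n + 1 : ℕ) * v / 8)) := by gcongr
    _ = 16 * Real.exp (-((n + 1 : ℕ) * v / 8)) := by ring

lemma exp_neg_half_add_le_exp_neg_quarter {v : ℝ} (hv0 : 0 ≤ v) (hv1 : v ≤ 1) :
    Real.exp (-(v / 2)) + v / 8 ≤ Real.exp (-(v / 4)) := by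
  have half_le : 1 / 2 ≤ Real.exp (-(v / 2)) := by linarith [Real.one_sub_le_exp_neg (v / 2)]
  calc Real.exp (-(v / 2)) + v / 8 ≤ Real.exp (-(v / 2)) * (v / 4 + 1) := by nlinarith
    _ ≤ Real.exp (-(v / 2)) * Real.exp (v / 4) := by
      gcongr
      exact Real.add_one_le_exp _
    _ = Real.exp (-(v / 4)) := by
      rw [← Real.exp_add]
      ring_nf

lemma norm_exp_mul_sub_one {u : ℂ} (hu : ‖u‖ = 1) (r : ℝ) :
    ‖Complex.exp (r * (u - 1))‖ = Real.exp (-(r * ‖u - 1‖ ^ 2 / 2)) := by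
  have unit : u.re * u.re + u.im * u.im = 1 := by
    rw [← Complex.normSq_apply, Complex.normSq_eq_norm_sq, hu, one_pow]
  have re_sub_one : u.re - 1 = -(‖u - 1‖ ^ 2 / 2) := by
    rw [Complex.sq_norm, Complex.normSq_apply, Complex.sub_re, Complex.sub_im, Complex.one_re,
      Complex.one_im]
    linear_combination unit / 2
  rw [Complex.norm_exp, Complex.re_ofReal_mul, Complex.sub_re, Complex.one_re, re_sub_one]
  ring_nf

theorem IsOneDependentRow.norm_integral_pow_sum_sub_exp_le {Ω : Type*} [MeasurableSpace Ω]
    {μ : Measure Ω} [IsProbabilityMeasure μ] {n : ℕ} {X : ℕ → Ω → ℕ} {u : ℂ}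
    (h : IsOneDependentRow n X μ) (hν : 0 < nu1 X μ) (hM : 600 * maxMoment n X μ ≤ nu1 X μ)
    (hu : ‖u‖ = 1) :
    ‖∫ ω, u ^ (∑ k ∈ Finset.Icc 1 n, X k ω) ∂μ - Complex.exp (n * nu1 X μ * (u - 1))‖ ≤
      1200 * (maxMoment n X μ / nu1 X μ) * Real.exp (-(n * nu1 X μ * ‖u - 1‖ ^ 2 / 8)) := by
  have hM0 := maxMoment_nonneg n X μ
  have step := fun k hk => h.norm_mixedMoment_succ_sub_exp_mul_le hu.le hM (k := k) hk
  have hνs := nu1_mul_norm_sub_one_le hM hu.le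
  have norm_le_two : ‖u - 1‖ ≤ 2 := (norm_sub_le u 1).trans (by rw [hu, norm_one]; norm_num)
  set s := ‖u - 1‖
  have hv0 : 0 ≤ nu1 X μ * s ^ 2 := by positivity
  have hv1 : nu1 X μ * s ^ 2 ≤ 1 := by
    calc nu1 X μ * s ^ 2 = nu1 X μ * s * s := by ring
      _ ≤ 1 / 300 * 2 := by gcongr
      _ ≤ 1 := by norm_num
  have radius : ‖Complex.exp (nu1 X μ * (u - 1))‖ + 75 * maxMoment n X μ * s ^ 2 ≤
      Real.exp (-(nu1 X μ * s ^ 2 / 4)) := by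
    rw [norm_exp_mul_sub_one hu]
    refine le_trans ?_ (exp_neg_half_add_le_exp_neg_quarter hv0 hv1)
    gcongr
    nlinarith [sq_nonneg s]
  have compare := norm_sub_pow_mul_le
    (F := fun k => mixedMoment X μ (fun N => u ^ N) (Finset.Ico 1 (k + 1))) (by positivity) radius
    step
  simp only [zero_add, Finset.Ico_self, mixedMoment_empty, norm_one, mul_one] at compare
  simp only [mixedMoment, Finset.Ico_add_one_right_eq_Icc, Finset.prod_pow_eq_pow_sum,
    ← Complex.exp_nat_mul, ← mul_assoc] at compare
  calc _ ≤ _ := compare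
    _ = 75 * (maxMoment n X μ / nu1 X μ) *
        (n * (nu1 X μ * s ^ 2) * Real.exp (-(nu1 X μ * s ^ 2 / 4)) ^ (n - 1)) := by field_simp
    _ ≤ 75 * (maxMoment n X μ / nu1 X μ) * (16 * Real.exp (-(n * (nu1 X μ * s ^ 2) / 8))) :=
      mul_le_mul_of_nonneg_left (natCast_mul_exp_pow_pred_le hv0 hv1 n) (by positivity)
    _ = 1200 * (maxMoment n X μ / nu1 X μ) * Real.exp (-(n * nu1 X μ * s ^ 2 / 8)) := by ring_nf

end PoissonApproximation

section FourierInversion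

lemma integral_exp_int_mul_I (k : ℤ) :
    ∫ t in -Real.pi..Real.pi, Complex.exp (k * Complex.I * t) =
      if k = 0 then (2 * Real.pi : ℂ) else 0 := by
  split_ifs with hk
  · simp [hk, two_mul]
  · have hc : (k : ℂ) * Complex.I ≠ 0 := mul_ne_zero (Int.cast_ne_zero.2 hk) Complex.I_ne_zero
    rw [integral_exp_mul_complex hc, div_eq_zero_iff, sub_eq_zero]
    exact .inl (Complex.exp_eq_exp_iff_exists_int.2 ⟨k, by push_cast; ring⟩)

lemma charFun_map_natCast (P : Measure ℕ) (t : ℝ) :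
    charFun (P.map (Nat.cast : ℕ → ℝ)) t = ∫ N, Complex.exp (t * Complex.I) ^ N ∂P := by
  rw [charFun_apply_real, integral_map .of_discrete (by fun_prop)]
  simp only [← Complex.exp_nat_mul, Complex.ofReal_natCast]
  congr! 3
  ring

theorem integral_exp_mul_charFun_map_natCast (P : Measure ℕ) [IsFiniteMeasure P] (x : ℕ) :
    ∫ t in -Real.pi..Real.pi,
      Complex.exp (-(x * Complex.I * t)) * charFun (P.map (Nat.cast : ℕ → ℝ)) t =
      2 * Real.pi * P.real {x} := by
  have shift (t : ℝ) (N : ℕ) : Complex.exp (-(x * Complex.I * t)) *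
      Complex.exp (t * Complex.I) ^ N = Complex.exp ((N - x : ℤ) * Complex.I * t) := by
    rw [← Complex.exp_nat_mul, ← Complex.exp_add]
    push_cast
    ring_nf
  have integrable : Integrable (Function.uncurry fun (t : ℝ) (N : ℕ) =>
      Complex.exp ((N - x : ℤ) * Complex.I * t))
      ((volume.restrict (Set.uIoc (-Real.pi) Real.pi)).prod P) := by
    rw [Set.uIoc_of_le (by linarith [Real.pi_pos])]
    refine .of_bound (C := 1) (Measurable.aestronglyMeasurable ?_) (ae_of_all _ fun p => ?_)
    · exact measurable_from_prod_countable_left fun N => by fun_prop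
    · simp [Function.uncurry_def, Complex.norm_exp]
  simp only [charFun_map_natCast, ← integral_const_mul, shift]
  rw [intervalIntegral_integral_swap integrable]
  simp only [integral_exp_int_mul_I]
  have indicator (N : ℕ) : (if (N - x : ℤ) = 0 then (2 * Real.pi : ℂ) else 0) =
      Set.indicator {x} (fun _ => (2 * Real.pi : ℂ)) N := by
    simp [Set.indicator_apply, sub_eq_zero]
  simp only [indicator]
  rw [integral_indicator (measurableSet_singleton x), setIntegral_const]
  simp [mul_comm]

theorem abs_measureReal_singleton_sub_le {P Q : Measure ℕ} [IsFiniteMeasure P] [IsFiniteMeasure Q]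
    {C c : ℝ} (hc : 0 < c)
    (h : ∀ t : ℝ, |t| ≤ Real.pi → ‖charFun (P.map (Nat.cast : ℕ → ℝ)) t -
      charFun (Q.map (Nat.cast : ℕ → ℝ)) t‖ ≤ C * Real.exp (-c * t ^ 2)) (x : ℕ) :
    |P.real {x} - Q.real {x}| ≤ C / (2 * √(Real.pi * c)) := by
  have hpi := Real.pi_pos
  have hC : 0 ≤ C := by simpa using (norm_nonneg _).trans (h 0 (by simpa using hpi.le))
  have continuous_exp : Continuous fun t : ℝ => Complex.exp (-(x * Complex.I * t)) := by fun_prop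
  have diff_eq : ∫ t in -Real.pi..Real.pi, Complex.exp (-(x * Complex.I * t)) *
      (charFun (P.map (Nat.cast : ℕ → ℝ)) t - charFun (Q.map (Nat.cast : ℕ → ℝ)) t) =
      (2 * Real.pi * (P.real {x} - Q.real {x}) : ℝ) := by
    simp only [mul_sub]
    rw [intervalIntegral.integral_sub
      (intervalIntegrable_charFun.continuousOn_mul continuous_exp.continuousOn)
      (intervalIntegrable_charFun.continuousOn_mul continuous_exp.continuousOn),
      integral_exp_mul_charFun_map_natCast, integral_exp_mul_charFun_map_natCast]
    push_cast
    ring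
  have gaussian_le : ∫ t in -Real.pi..Real.pi, Real.exp (-c * t ^ 2) ≤ √(Real.pi / c) := by
    rw [← integral_gaussian, intervalIntegral.integral_of_le (by linarith)]
    exact setIntegral_le_integral (integrable_exp_neg_mul_sq hc)
      (ae_of_all _ fun _ => (Real.exp_pos _).le)
  have norm_le : 2 * Real.pi * |P.real {x} - Q.real {x}| ≤ C * √(Real.pi / c) := by
    calc 2 * Real.pi * |P.real {x} - Q.real {x}|
        = ‖((2 * Real.pi * (P.real {x} - Q.real {x}) : ℝ) : ℂ)‖ := by
          rw [Complex.norm_real, Real.norm_eq_abs, abs_mul, abs_of_pos Real.two_pi_pos]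
      _ ≤ ∫ t in -Real.pi..Real.pi, C * Real.exp (-c * t ^ 2) := by
          rw [← diff_eq]
          refine intervalIntegral.norm_integral_le_of_norm_le (by linarith)
            (ae_of_all _ fun t ht => ?_) (Continuous.intervalIntegrable (by fun_prop) _ _)
          have norm_exp : ‖Complex.exp (-(x * Complex.I * t))‖ = 1 := by simp [Complex.norm_exp]
          rw [norm_mul, norm_exp, one_mul]
          exact h t (abs_le.2 ⟨ht.1.le, ht.2⟩)
      _ ≤ C * √(Real.pi / c) := by
          rw [intervalIntegral.integral_const_mul]
          gcongr
  have sqrt_mul_sqrt : √(Real.pi / c) * √(Real.pi * c) = Real.pi := by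
    rw [← Real.sqrt_mul (by positivity), div_mul_eq_mul_div, mul_div_assoc,
      mul_div_cancel_right₀ _ hc.ne', Real.sqrt_mul_self hpi.le]
  have key := mul_le_mul_of_nonneg_right norm_le (Real.sqrt_nonneg (Real.pi * c))
  rw [mul_assoc C, sqrt_mul_sqrt] at key
  rw [le_div_iff₀ (by positivity)]
  exact le_of_mul_le_mul_right (by linarith) hpi

end FourierInversion

section LocalLimit

lemma mul_sq_le_norm_exp_mul_I_sub_one_sq {t : ℝ} (ht : |t| ≤ Real.pi) :
    4 / Real.pi ^ 2 * t ^ 2 ≤ ‖Complex.exp (t * Complex.I) - 1‖ ^ 2 := by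
  have norm_sq : ‖Complex.exp (t * Complex.I) - 1‖ ^ 2 = 2 * (1 - Real.cos t) := by
    rw [Complex.sq_norm, Complex.normSq_apply]
    simp only [Complex.sub_re, Complex.sub_im, Complex.exp_ofReal_mul_I_re,
      Complex.exp_ofReal_mul_I_im, Complex.one_re, Complex.one_im]
    linear_combination Real.sin_sq_add_cos_sq t
  rw [norm_sq]
  linear_combination 2 * Real.cos_le_one_sub_mul_cos_sq ht

theorem IsOneDependentRow.abs_probSum_sub_probPoisson_le {Ω : Type*} [MeasurableSpace Ω]
    {μ : Measure Ω} [IsProbabilityMeasure μ] {n : ℕ} {X : ℕ → Ω → ℕ}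
    (h : IsOneDependentRow n X μ) (hM : 600 * maxMoment n X μ ≤ nu1 X μ)
    (hL : 0 < n * nu1 X μ) (x : ℕ) :
    |probSum n X μ x - probPoisson n X μ x| ≤
      600 * √(2 * Real.pi) * (maxMoment n X μ / nu1 X μ) * (1 / √(n * nu1 X μ)) := by
  have hν : 0 < nu1 X μ := pos_of_mul_pos_right hL (Nat.cast_nonneg n)
  have hM0 := maxMoment_nonneg n X μ
  have sum_measurable : Measurable fun ω => ∑ k ∈ Finset.Icc 1 n, X k ω :=
    Finset.measurable_fun_sum _ h.measurable
  have charFun_close (t : ℝ) (ht : |t| ≤ Real.pi) :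
      ‖charFun ((μ.map fun ω => ∑ k ∈ Finset.Icc 1 n, X k ω).map (Nat.cast : ℕ → ℝ)) t -
        charFun ((poissonMeasure (n * nu1 X μ).toNNReal).map (Nat.cast : ℕ → ℝ)) t‖ ≤
      1200 * (maxMoment n X μ / nu1 X μ) *
        Real.exp (-(n * nu1 X μ / (2 * Real.pi ^ 2)) * t ^ 2) := by
    rw [charFun_map_natCast, integral_map sum_measurable.aemeasurable (by fun_prop),
      charFun_map_cast_poissonMeasure, Real.coe_toNNReal _ hL.le]
    push_cast
    refine (h.norm_integral_pow_sum_sub_exp_le hν hM (Complex.norm_exp_ofReal_mul_I t)).trans ?_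
    gcongr
    linear_combination n * nu1 X μ / 8 * mul_sq_le_norm_exp_mul_I_sub_one_sq ht
  have comparison := abs_measureReal_singleton_sub_le (by positivity) charFun_close x
  rw [map_measureReal_apply sum_measurable (measurableSet_singleton x)] at comparison
  refine comparison.trans_eq ?_
  have sqrt_eq : √(Real.pi * (n * nu1 X μ / (2 * Real.pi ^ 2))) * √(2 * Real.pi) =
      √(n * nu1 X μ) := by
    rw [← Real.sqrt_mul (by positivity)]
    congr 1
    field_simp
  rw [← sqrt_eq]
  have := Real.sqrt_pos.2 Real.two_pi_pos
  field_simp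
  ring

theorem probSum_sub_probPoisson_isLittleO {Ω : ℕ → Type*} [∀ n, MeasurableSpace (Ω n)]
    {μ : ∀ n, Measure (Ω n)} [∀ n, IsProbabilityMeasure (μ n)] {X : ∀ n, ℕ → Ω n → ℕ}
    (hrow : ∀ᶠ n in atTop, IsOneDependentRow n (X n) (μ n))
    (hmax : (fun n : ℕ => maxMoment n (X n) (μ n)) =o[atTop] fun n : ℕ => nu1 (X n) (μ n))
    (hmean : Tendsto (fun n : ℕ => (n : ℝ) * nu1 (X n) (μ n)) atTop atTop) (x : ℕ → ℕ) :
    (fun n => probSum n (X n) (μ n) (x n) - probPoisson n (X n) (μ n) (x n)) =o[atTop]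
      fun n : ℕ => 1 / √(n * nu1 (X n) (μ n)) := by
  have bound : (fun n => probSum n (X n) (μ n) (x n) - probPoisson n (X n) (μ n) (x n)) =O[atTop]
      fun n : ℕ => maxMoment n (X n) (μ n) / nu1 (X n) (μ n) * (1 / √(n * nu1 (X n) (μ n))) := by
    refine .of_bound (600 * √(2 * Real.pi)) ?_
    filter_upwards [hrow, hmax.bound (show (0 : ℝ) < 1 / 600 by norm_num),
      hmean.eventually_gt_atTop 0] with n row small hL
    rw [Real.norm_of_nonneg (maxMoment_nonneg _ _ _), Real.norm_of_nonneg (nu1_nonneg _ _)] at small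
    refine (row.abs_probSum_sub_probPoisson_le (by linarith) hL (x n)).trans ?_
    rw [mul_assoc]
    gcongr
    exact Real.le_norm_self _
  simpa using bound.trans_isLittleO
    (((isLittleO_one_iff ℝ).2 hmax.tendsto_div_nhds_zero).mul_isBigO (isBigO_refl _ _))

end LocalLimit

section PoissonLowerBound

lemma factorial_le_exp_one_mul_sqrt_mul_pow {x : ℕ} (hx : 0 < x) :
    (x.factorial : ℝ) ≤ Real.exp 1 * √x * (x / Real.exp 1) ^ x := by
  obtain ⟨k, rfl⟩ := Nat.exists_eq_succ_of_ne_zero hx.ne'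
  have stirling := Stirling.stirlingSeq'_antitone (Nat.zero_le k)
  simp only [Function.comp, Nat.succ_eq_add_one, zero_add, Stirling.stirlingSeq_one] at stirling
  rw [Stirling.stirlingSeq, div_le_iff₀ (by positivity)] at stirling
  refine stirling.trans_eq ?_
  rw [Real.sqrt_mul zero_le_two]
  field_simp

theorem exp_div_le_poissonMeasure_real_singleton {L : NNReal} (hL : 0 < L) {x : ℕ} (hx : 0 < x) :
    Real.exp (-((x - L) ^ 2 / L)) / (Real.exp 1 * √x) ≤ (poissonMeasure L).real {x} := by
  have : (0 : ℝ) < L := hL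
  have pow_le : (x / L : ℝ) ^ x ≤ Real.exp ((x - L) ^ 2 / L) * Real.exp (x - L) := by
    calc (x / L : ℝ) ^ x ≤ Real.exp (x / L - 1) ^ x := by
          gcongr
          linarith [Real.add_one_le_exp (x / L - 1 : ℝ)]
      _ = Real.exp ((x - L) ^ 2 / L) * Real.exp (x - L) := by
          rw [← Real.exp_nat_mul, ← Real.exp_add]
          congr 1
          field_simp
          ring
  rw [poissonMeasure_real_singleton, div_le_div_iff₀ (by positivity) (by positivity)]
  calc Real.exp (-((x - L) ^ 2 / L)) * (x.factorial : ℝ)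
      ≤ Real.exp (-((x - L) ^ 2 / L)) * (Real.exp 1 * √x * (x / Real.exp 1) ^ x) := by
        gcongr
        exact factorial_le_exp_one_mul_sqrt_mul_pow hx
    _ = Real.exp (-((x - L) ^ 2 / L)) * (x / L : ℝ) ^ x *
          (Real.exp (-x) * L ^ x * (Real.exp 1 * √x)) := by
        rw [div_pow, div_pow, ← Real.exp_nat_mul, mul_one, Real.exp_neg x]
        field_simp
    _ ≤ Real.exp (-((x - L) ^ 2 / L)) * (Real.exp ((x - L) ^ 2 / L) * Real.exp (x - L)) *
          (Real.exp (-x) * L ^ x * (Real.exp 1 * √x)) := by gcongr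
    _ = Real.exp (-L) * L ^ x * (Real.exp 1 * √x) := by
        have exp_cancel : Real.exp (-((x - L) ^ 2 / L)) *
            (Real.exp ((x - L) ^ 2 / L) * Real.exp (x - L)) * Real.exp (-x) = Real.exp (-L) := by
          simp only [← Real.exp_add]
          ring_nf
        linear_combination L ^ x * (Real.exp 1 * √x) * exp_cancel

theorem one_div_sqrt_isBigO_poissonMeasure {ι : Type*} {l : Filter ι} {L : ι → NNReal} {x : ι → ℕ}
    (hL : Tendsto L l atTop)
    (hx : (fun i => (x i : ℝ) - L i) =O[l] fun i => √(L i : ℝ)) :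
    (fun i => 1 / √(L i : ℝ)) =O[l] fun i => (poissonMeasure (L i)).real {x i} := by
  obtain ⟨C, hC, hxC⟩ := hx.exists_pos
  have sqrt_tendsto : Tendsto (fun i => √(L i : ℝ)) l atTop :=
    Real.tendsto_sqrt_atTop.comp (NNReal.tendsto_coe_atTop.2 hL)
  refine .of_bound (Real.exp (C ^ 2) * (Real.exp 1 * √2)) ?_
  filter_upwards [hxC.bound, sqrt_tendsto.eventually_gt_atTop C] with i dev_le hCL
  set r := √(L i : ℝ)
  have hr : 0 < r := hC.trans hCL
  have L_eq : (L i : ℝ) = r ^ 2 := (Real.sq_sqrt (L i).coe_nonneg).symm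
  rw [Real.norm_eq_abs, Real.norm_of_nonneg hr.le, abs_le, L_eq] at dev_le
  have hx0 : (0 : ℝ) < x i := by nlinarith
  have sqrt_le : √(x i : ℝ) ≤ √2 * r := by
    rw [← Real.sqrt_sq hr.le, ← Real.sqrt_mul zero_le_two]
    gcongr
    nlinarith
  have sq_dev_le : ((x i : ℝ) - L i) ^ 2 / L i ≤ C ^ 2 := by
    rw [L_eq, div_le_iff₀ (by positivity), ← mul_pow]
    exact sq_le_sq' (by linarith) dev_le.2
  have lower := exp_div_le_poissonMeasure_real_singleton
    (NNReal.coe_pos.1 (by rw [L_eq]; positivity)) (Nat.cast_pos.1 hx0)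
  rw [Real.norm_of_nonneg (by positivity), Real.norm_of_nonneg measureReal_nonneg]
  calc 1 / r = Real.exp (C ^ 2) * (Real.exp 1 * √2) *
        (Real.exp (-C ^ 2) / (Real.exp 1 * (√2 * r))) := by
        rw [Real.exp_neg]
        field_simp
    _ ≤ Real.exp (C ^ 2) * (Real.exp 1 * √2) *
        (Real.exp (-((x i - L i) ^ 2 / L i)) / (Real.exp 1 * √(x i))) := by gcongr
    _ ≤ _ := by gcongr

end PoissonLowerBound

end LocalPoisson

theorem corollary1_general {Ω : ℕ → Type*} [∀ n, MeasurableSpace (Ω n)]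
    (μ : ∀ n, Measure (Ω n)) [∀ n, IsProbabilityMeasure (μ n)]
    (X : ∀ n, ℕ → Ω n → ℕ) (x : ℕ → ℕ)
    (hrow : ∀ᶠ n in atTop, LocalPoisson.IsOneDependentRow n (X n) (μ n))
    (hx : (fun n : ℕ => (x n : ℝ) - n * LocalPoisson.nu1 (X n) (μ n))
      =O[atTop] fun n : ℕ => √(n * LocalPoisson.nu1 (X n) (μ n)))
    (hmax : (fun n : ℕ => LocalPoisson.maxMoment n (X n) (μ n))
      =o[atTop] fun n : ℕ => LocalPoisson.nu1 (X n) (μ n))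
    (hmean : Tendsto (fun n : ℕ => (n : ℝ) * LocalPoisson.nu1 (X n) (μ n)) atTop atTop) :
    Tendsto (fun n : ℕ => LocalPoisson.probSum n (X n) (μ n) (x n)
      / LocalPoisson.probPoisson n (X n) (μ n) (x n)) atTop (𝓝 1) := by
  have coe_mean (n : ℕ) : ((n * LocalPoisson.nu1 (X n) (μ n)).toNNReal : ℝ) =
      n * LocalPoisson.nu1 (X n) (μ n) :=
    Real.coe_toNNReal _ (mul_nonneg n.cast_nonneg (LocalPoisson.nu1_nonneg _ _))
  have poisson_lower := LocalPoisson.one_div_sqrt_isBigO_poissonMeasure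
    (tendsto_real_toNNReal_atTop.comp hmean) (x := x) (by simpa only [Function.comp, coe_mean])
  simp only [Function.comp, coe_mean] at poisson_lower
  have probPoisson_ne_zero : ∀ᶠ n in atTop, LocalPoisson.probPoisson n (X n) (μ n) (x n) ≠ 0 := by
    filter_upwards [hmean.eventually_gt_atTop 0] with n hn
    exact (poissonMeasure_real_singleton_pos _ (Real.toNNReal_pos.2 hn)).ne'
  refine (isEquivalent_iff_tendsto_one probPoisson_ne_zero).1
    (IsLittleO.isEquivalent (.trans_isBigO ?_ poisson_lower))
  exact LocalPoisson.probSum_sub_probPoisson_isLittleO hrow hmax hmean x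

theorem corollary1 {Ω : ℕ → Type*} [∀ n, MeasurableSpace (Ω n)]
    (μ : ∀ n, Measure (Ω n)) [∀ n, IsProbabilityMeasure (μ n)]
    (X : ∀ n, ℕ → Ω n → ℕ) (x : ℕ → ℕ) (C₀ : ℝ) (hC₀ : 1 ≤ C₀)
    (hsetting : ∀ᶠ n in atTop, LocalPoisson.Setting C₀ n (X n) (μ n) (x n))
    (hx : (fun n : ℕ => (x n : ℝ) - n * LocalPoisson.nu1 (X n) (μ n))
      =o[atTop] fun n : ℕ => √(n * LocalPoisson.nu1 (X n) (μ n)))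
    (hgam : (fun n : ℕ => LocalPoisson.gam C₀ n (X n) (μ n))
      =o[atTop] fun n : ℕ => LocalPoisson.nu1 (X n) (μ n))
    (hnu : Tendsto (fun n : ℕ => LocalPoisson.nu1 (X n) (μ n)) atTop (𝓝 0))
    (hmean : Tendsto (fun n : ℕ => (n : ℝ) * LocalPoisson.nu1 (X n) (μ n)) atTop atTop) :
    Tendsto (fun n : ℕ => LocalPoisson.probSum n (X n) (μ n) (x n)
      / LocalPoisson.probPoisson n (X n) (μ n) (x n)) atTop (𝓝 1) := by
  exact corollary1_general μ X x (hsetting.mono fun _ h => h.isOneDependentRow) hx.isBigO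
    ((isLittleO_const_mul_left_iff (Real.exp_ne_zero _)).1 hgam) hmean
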